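/- Let $k$ be an algebraically closed field of characteristic zero. For $n \ge 1$ let ${\rm Cr}_n = {\rm Bir}({\bf A}^n)$ be the group of birational self-maps of ${\bf A}^n$ over $k$ under composition; it contains ${\rm GL}_n(k)$ as the group of invertible linear maps. A (faithful) rational action of a finite group $G$ on ${\bf A}^n$ is an injective group homomorphism $\varrho\colon G\hookrightarrow {\rm Bir}({\bf A}^n)$. For rational actions $\varrho_1,\varrho_2$ of $G$ on ${\bf A}^n$, one says that $\varrho_1$ is obtained by a nontrivial base change from $\varrho_2$ if there is a $G$-equivariant dominant rational map $\varphi\colon {\bf A}^n\dashrightarrow{\bf A}^n$, i.e. $\varphi\circ\varrho_1(g)=\varrho_2(g)\circ\varphi$ for all $g\in G$, which is not a birational isomorphism (the base change is along the map of rational quotients by $G$ that $\varphi$ induces). Theorem. Let $G$ be a non-Abelian finite group that is not isomorphic to a dihedral group, and let $\lambda\colon G\hookrightarrow {\rm GL}_2(k)$ be a faithful linear representation. Then every faithful rational action $\varrho\colon G\hookrightarrow {\rm Bir}({\bf A}^2)$ of $G$ on ${\bf A}^2$ is obtained by a nontrivial base change from the linear action $\lambda$ of $G$ on ${\bf A}^2$;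 that is, there is a dominant rational map $\varphi\colon {\bf A}^2\dashrightarrow{\bf A}^2$, not a birational isomorphism, such that $\varphi\circ\varrho(g)=\lambda(g)\circ\varphi$ for all $g\in G$. -/

import Mathlib

open MvPolynomial

noncomputable section

/-- The field `k(x₁, …, xₙ)` of rational functions on affine space `𝔸ⁿ`. -/
abbrev RatFunField (n : ℕ) (k : Type*) [Field k] : Type _ :=
  FractionRing (MvPolynomial (Fin n) k)

/-- A dominant rational map `σ = (σ₁, …, σₙ) : 𝔸ⁿ ⇢ 𝔸ⁿ`, given by its coordinate functions
`σᵢ = σ^*(xᵢ) ∈ k(x₁, …, xₙ)`.  Dominance says that the image lies in no hypersurface: no nonzero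
polynomial `P` satisfies `P(σ₁, …, σₙ) = 0`. -/
@[ext]
structure DomRatMap (n : ℕ) (k : Type*) [Field k] where
  /-- The coordinate functions of the rational map. -/
  coord : Fin n → RatFunField n k
  /-- The image is Zariski dense. -/
  dominant : ∀ P : MvPolynomial (Fin n) k, aeval coord P = 0 → P = 0

theorem aeval_algebraMap_coord {n : ℕ} {k : Type*} [Field k]
    (f : Fin n → MvPolynomial (Fin n) k) (P : MvPolynomial (Fin n) k) :
    aeval (fun i => algebraMap (MvPolynomial (Fin n) k) (RatFunField n k) (f i)) P =
      algebraMap _ _ (aeval f P) :=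
  aeval_algebraMap_apply _ f P

namespace DomRatMap

variable {n : ℕ} {k : Type*} [Field k]

theorem aeval_injective (τ : DomRatMap n k) :
    Function.Injective (aeval τ.coord : MvPolynomial (Fin n) k →ₐ[k] RatFunField n k) :=
  (injective_iff_map_eq_zero _).2 τ.dominant

/-- The pull-back `τ^* : k(x₁, …, xₙ) → k(x₁, …, xₙ)` of rational functions along a dominant
rational map: it plugs in `τⱼ` in place of `xⱼ` for every `j`. -/
def pullback (τ : DomRatMap n k) : RatFunField n k →ₐ[k] RatFunField n k :=
  IsFractionRing.liftAlgHom τ.aeval_injective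

@[simp]
theorem pullback_algebraMap (τ : DomRatMap n k) (P : MvPolynomial (Fin n) k) :
    τ.pullback (algebraMap _ _ P) = aeval τ.coord P := by
  simp [pullback]

theorem pullback_aeval (τ : DomRatMap n k) (f : Fin n → RatFunField n k)
    (P : MvPolynomial (Fin n) k) :
    τ.pullback (aeval f P) = aeval (fun i => τ.pullback (f i)) P := by
  rw [← AlgHom.comp_apply, comp_aeval]

/-- The composition `σ ∘ τ`, with coordinate functions `(σ ∘ τ)ᵢ = τ^*(σᵢ)`. -/
protected def comp (σ τ : DomRatMap n k) : DomRatMap n k where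
  coord i := τ.pullback (σ.coord i)
  dominant P hP := by
    rw [← pullback_aeval] at hP
    exact σ.dominant P ((map_eq_zero_iff _ τ.pullback.toRingHom.injective).1 hP)

/-- The identity map `(x₁, …, xₙ)`. -/
protected def id : DomRatMap n k where
  coord i := algebraMap (MvPolynomial (Fin n) k) _ (X i)
  dominant P hP := by
    rw [aeval_algebraMap_coord, aeval_X_left_apply] at hP
    exact (map_eq_zero_iff _ (IsFractionRing.injective _ _)).1 hP

theorem pullback_comp (σ τ : DomRatMap n k) (f : RatFunField n k) :
    (σ.comp τ).pullback f = τ.pullback (σ.pullback f) := by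
  obtain ⟨p, q, -, rfl⟩ := IsFractionRing.div_surjective (A := MvPolynomial (Fin n) k) f
  simp [map_div₀, pullback_aeval, DomRatMap.comp]

theorem pullback_id (f : RatFunField n k) : (DomRatMap.id : DomRatMap n k).pullback f = f := by
  obtain ⟨p, q, -, rfl⟩ := IsFractionRing.div_surjective (A := MvPolynomial (Fin n) k) f
  simp [map_div₀, DomRatMap.id, aeval_algebraMap_coord]

/-- Dominant rational self-maps of `𝔸ⁿ` form a monoid under composition, `σ * τ = σ ∘ τ`. -/
instance : Monoid (DomRatMap n k) where
  mul := DomRatMap.comp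
  one := DomRatMap.id
  mul_assoc σ τ υ := DomRatMap.ext (funext fun i => (pullback_comp τ υ (σ.coord i)).symm)
  one_mul σ := DomRatMap.ext (funext fun i => by
    change σ.pullback (algebraMap _ _ (X i)) = _
    simp)
  mul_one σ := DomRatMap.ext (funext fun i => pullback_id (σ.coord i))

/-- A rational self-map of `𝔸ⁿ` is a birational isomorphism if it has an inverse rational map. -/
def IsBirational (σ : DomRatMap n k) : Prop := IsUnit σ

end DomRatMap

/-- The Cremona group `Crₙ(k) = Bir(𝔸ⁿ)` of birational self-maps of `𝔸ⁿ`, with composition as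
multiplication. -/
abbrev Cremona (n : ℕ) (k : Type*) [Field k] : Type _ := (DomRatMap n k)ˣ

section Linear

variable {n : ℕ} {k : Type*} [Field k]

/-- The linear forms `(A x)ᵢ = ∑ⱼ Aᵢⱼ xⱼ`. -/
def linearForm (A : Matrix (Fin n) (Fin n) k) (i : Fin n) : MvPolynomial (Fin n) k :=
  ∑ j, C (A i j) * X j

theorem aeval_linearForm (A B : Matrix (Fin n) (Fin n) k) (i : Fin n) :
    aeval (linearForm B) (linearForm A i) = linearForm (A * B) i := by
  simp only [linearForm, map_sum, map_mul, aeval_X, Matrix.mul_apply, Finset.sum_mul,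
    Finset.mul_sum, algHom_C, algebraMap_eq]
  rw [Finset.sum_comm]
  simp only [mul_assoc]

theorem linearForm_one (i : Fin n) : linearForm (1 : Matrix (Fin n) (Fin n) k) i = X i := by
  simp [linearForm, Matrix.one_apply]

/-- The invertible linear map `a ↦ A a` as a rational self-map of `𝔸ⁿ`. -/
def linearRatMap (A : GL (Fin n) k) : DomRatMap n k where
  coord i := algebraMap (MvPolynomial (Fin n) k) _ (linearForm A.val i)
  dominant P hP := by
    rw [aeval_algebraMap_coord] at hP
    have h := (map_eq_zero_iff _ (IsFractionRing.injective _ _)).1 hP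
    have h' := congrArg (aeval (linearForm A⁻¹.val)) h
    rw [← AlgHom.comp_apply, comp_aeval, map_zero] at h'
    have h'' : (fun i => aeval (linearForm A⁻¹.val) (linearForm A.val i)) = X := funext fun i => by
      rw [aeval_linearForm, ← Units.val_mul, mul_inv_cancel, Units.val_one, linearForm_one]
    rwa [h'', aeval_X_left_apply] at h'

/-- The embedding `GLₙ(k) ⊆ Crₙ(k)`. -/
def glToCremona (n : ℕ) (k : Type*) [Field k] : GL (Fin n) k →* Cremona n k :=
  MonoidHom.toHomUnits
    { toFun := linearRatMap
      map_one' := DomRatMap.ext (funext fun i => by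
        change algebraMap _ _ (linearForm 1 i) = algebraMap _ _ (X i)
        rw [linearForm_one])
      map_mul' := fun A B => DomRatMap.ext (funext fun i => by
        change algebraMap _ _ (linearForm (A.val * B.val) i) =
          (linearRatMap B).pullback (algebraMap _ _ (linearForm A.val i))
        rw [DomRatMap.pullback_algebraMap, ← aeval_linearForm]
        exact (aeval_algebraMap_coord _ _).symm) }

end Linear

/-- A (faithful) rational action of `G` on `𝔸ⁿ`: an embedding `G ↪ Bir(𝔸ⁿ)`. -/
structure RationalAction (G : Type*) [Group G] (n : ℕ) (k : Type*) [Field k] where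
  /-- The homomorphism to the Cremona group. -/
  toHom : G →* Cremona n k
  /-- The action is faithful. -/
  faithful : Function.Injective toHom

section Actions

variable {G : Type*} [Group G] {n : ℕ} {k : Type*} [Field k]

theorem glToCremona_injective : Function.Injective (glToCremona n k) := by
  intro A B h
  have h1 : linearRatMap A = linearRatMap B := congrArg Units.val h
  ext i j
  have h2 : linearForm A.val i = linearForm B.val i :=
    IsFractionRing.injective _ (RatFunField n k) (congrFun (congrArg DomRatMap.coord h1) i)
  have h3 := congrArg (eval (Pi.single j (1 : k))) h2
  simpa [linearForm, Pi.single_apply] using h3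

/-- The linear action on `𝔸ⁿ` of a group with a faithful linear representation `G ↪ GLₙ(k)`. -/
def linearAction (lam : G →* GL (Fin n) k) (hlam : Function.Injective lam) :
    RationalAction G n k where
  toHom := (glToCremona n k).comp lam
  faithful := glToCremona_injective.comp hlam

/-- A compression of `ρ₁` into `ρ₂`: a `G`-equivariant dominant rational map `φ`, i.e.
`φ ∘ ρ₁(g) = ρ₂(g) ∘ φ` for all `g`. -/
def IsCompression (ρ₁ ρ₂ : RationalAction G n k) (φ : DomRatMap n k) : Prop :=
  ∀ g : G, φ * (ρ₁.toHom g : DomRatMap n k) = (ρ₂.toHom g : DomRatMap n k) * φ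

/-- `ρ₁` is obtained by a nontrivial base change from `ρ₂`: there is a compression of `ρ₁` into
`ρ₂` that is not a birational isomorphism.  (The base change in question is along the map of
rational quotients that `φ` induces.) -/
def IsNontrivialBaseChange (ρ₁ ρ₂ : RationalAction G n k) : Prop :=
  ∃ φ : DomRatMap n k, IsCompression ρ₁ ρ₂ φ ∧ ¬ φ.IsBirational

end Actions

end

/-! Averaging a rational function over `G` against the matrices of `lam` gives an equivariant
rational map `f` from the plane to `k²`; it can be made nonzero because the pullbacks `ρ(g)^*` are
linearly independent (Dedekind). If the direction `f 0 / f 1` were constant, the image would span a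
line stable under `G`, and `commute_of_common_eigenvector` would make `G` Abelian. So the direction
is transcendental, and multiplying `f` by a suitable invariant function makes it dominant.

If the resulting `φ` happens to be birational, it is followed by `v ↦ F(v) v`, where `F` is an
invariant form of positive degree `d`. This map commutes with `lam` but identifies `v` with `ζ v`
for `ζ ^ (d + 1) = 1`, so the composite is not birational. -/

section AlgebraicIndependence

variable {k K : Type*} [Field k] [Field K] [Algebra k K]

theorem algebraicIndependent_pair {t g : K} (ht : Transcendental k t)
    (hg : Transcendental (Algebra.adjoin k {t}) g) : AlgebraicIndependent k ![t, g] := by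
  have h1 : AlgebraicIndependent k (fun _ : Unit => t) := by
    rwa [algebraicIndependent_unique_type_iff]
  have h2 := (h1.option_iff_transcendental g).2 (by rwa [Set.range_const])
  let e : Fin 2 → Option Unit := ![some (), none]
  have he : Function.Injective e := by
    intro i j
    fin_cases i <;> fin_cases j <;> simp [e]
  have h3 := h2.comp e he
  convert h3 using 1
  funext i
  fin_cases i <;> rfl

/-- The substitution `(x, y) ↦ (xy, y)` has the rational inverse `(x / y, y)`. -/
theorem AlgebraicIndependent.pair_mul {t g : K} (h : AlgebraicIndependent k ![t, g]) :
    AlgebraicIndependent k ![t * g, g] := by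
  rw [algebraicIndependent_iff] at h ⊢
  intro P hP
  have h1 : aeval ![t, g] (aeval ![X 0 * X 1, (X 1 : MvPolynomial (Fin 2) k)] P) = 0 := by
    rw [← AlgHom.comp_apply, comp_aeval, ← hP]
    congr 2
    funext i
    fin_cases i <;> simp
  have h2 := h _ h1
  let x : Fin 2 → RatFunField 2 k := fun i => algebraMap (MvPolynomial (Fin 2) k) _ (X i)
  have hX : x 1 ≠ 0 := by simp [x]
  have h3 : aeval ![x 0 / x 1, x 1] (aeval ![X 0 * X 1, (X 1 : MvPolynomial (Fin 2) k)] P)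
      = aeval x P := by
    rw [← AlgHom.comp_apply, comp_aeval]
    congr 2
    funext i
    fin_cases i
    · simpa using div_mul_cancel₀ _ hX
    · simp
  rw [h2, map_zero] at h3
  exact DomRatMap.id.dominant P h3.symm

theorem not_isAlgebraic_adjoin_singleton {x : Fin 2 → K} (hx : AlgebraicIndependent k x) (t : K) :
    ¬ Algebra.IsAlgebraic (Algebra.adjoin k {t}) K := by
  intro h
  have h1 := Algebra.IsAlgebraic.trdeg_le_cardinalMk k ({t} : Set K)
  have h2 := hx.lift_cardinalMk_le_trdeg
  simp only [Cardinal.mk_fin, Cardinal.lift_natCast, Cardinal.mk_singleton] at h1 h2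
  have h3 := h2.trans (Cardinal.lift_le.2 h1)
  simp at h3

/-- `K` is integral over the fixed field of the finite group `G`, which by `h` lies in the algebraic
closure of `A` in `K`. -/
theorem isAlgebraic_of_fixedPoints {G : Type*} [Group G] [Finite G] [MulSemiringAction G K]
    (A : Subalgebra k K) (h : ∀ s : K, (∀ g : G, g • s = s) → IsAlgebraic A s) :
    Algebra.IsAlgebraic A K := by
  refine ⟨fun x => ?_⟩
  let L := Subalgebra.algebraicClosure A K
  let j : FixedPoints.subfield G K →+* L :=
    (algebraMap (FixedPoints.subfield G K) K).codRestrict L fun s => h s s.2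
  have hx : IsIntegral L x := by
    obtain ⟨p, hp, hpx⟩ := FixedPoints.isIntegral G K x
    refine ⟨p.map j, hp.map j, ?_⟩
    rw [Polynomial.eval₂_map]
    exact hpx
  exact hx.isAlgebraic.restrictScalars A

end AlgebraicIndependence

/-! ### Equivariant maps by averaging -/

section Equivariant

theorem DomRatMap.pullback_injective {n : ℕ} {k : Type*} [Field k] :
    Function.Injective (DomRatMap.pullback : DomRatMap n k → _) := by
  intro σ τ h
  ext i
  simpa using DFunLike.congr_fun h (algebraMap (MvPolynomial (Fin n) k) _ (X i))

theorem DomRatMap.pullback_mul {n : ℕ} {k : Type*} [Field k] (σ τ : DomRatMap n k)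
    (f : RatFunField n k) : (σ * τ).pullback f = τ.pullback (σ.pullback f) :=
  DomRatMap.pullback_comp σ τ f

theorem RationalAction.exists_equivariant {k : Type*} [Field k] {G : Type*} [Group G] [Finite G]
    {n m : ℕ} [NeZero m] (ρ : RationalAction G n k) (A : G →* GL (Fin m) k) :
    ∃ f : Fin m → RatFunField n k, f ≠ 0 ∧ ∀ g i,
      (ρ.toHom g : DomRatMap n k).pullback (f i) = ∑ j, (A g).val i j • f j := by
  have := Fintype.ofFinite G
  let e : G → RatFunField n k →* RatFunField n k :=
    fun g => (ρ.toHom g : DomRatMap n k).pullback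
  have he : Function.Injective e := by
    intro g h hgh
    refine ρ.faithful (Units.ext (DomRatMap.pullback_injective ?_))
    exact AlgHom.ext fun x => DFunLike.congr_fun hgh x
  have hli := (linearIndependent_monoidHom (RatFunField n k) (RatFunField n k)).comp e he
  rw [Fintype.linearIndependent_iff] at hli
  -- The coefficient at `g = 1` is the corner entry `1` of the identity matrix, so the combination
  -- of distinct characters is not zero.
  obtain ⟨a, ha⟩ : ∃ a : RatFunField n k, ∑ g, (A g⁻¹).val 0 0 • e g a ≠ 0 := by
    by_contra! h
    have h1 := hli (fun g => algebraMap k _ ((A g⁻¹).val 0 0)) (by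
      funext a
      simpa [Algebra.smul_def] using h a) 1
    simp at h1
  refine ⟨fun i => ∑ g, (A g⁻¹).val i 0 • e g a, fun h => ha (congrFun h 0), fun h i => ?_⟩
  have hA : ∀ g, (A g⁻¹).val i 0 = ∑ j, (A h).val i j * (A (g * h)⁻¹).val j 0 := by
    intro g
    rw [← Matrix.mul_apply, ← Units.val_mul, ← map_mul, mul_inv_rev, mul_inv_cancel_left]
  have hE : ∀ g, (ρ.toHom h : DomRatMap n k).pullback (e g a) = e (g * h) a := by
    intro g
    simp [e, DomRatMap.pullback_mul]
  simp only [map_sum, map_smul, hE, Finset.smul_sum]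
  rw [Finset.sum_comm]
  refine Fintype.sum_equiv (Equiv.mulRight h) _ _ fun g => ?_
  simp only [Equiv.coe_mulRight, hA, Finset.sum_smul, smul_smul]

end Equivariant

/-! ### Common eigenvectors of finite linear groups -/

section Linear

theorem pow_one_add_of_mul_self_eq_zero {R : Type*} [Ring R] {N : R} (hN : N * N = 0) (m : ℕ) :
    (1 + N) ^ m = 1 + m • N := by
  induction m with
  | zero => simp
  | succ m ih =>
    rw [pow_succ, ih, add_mul, one_mul, mul_add, mul_one, smul_mul_assoc, hN, smul_zero, add_zero,
      succ_nsmul]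
    abel

/-- Both eigenvalues are `1`, so `U - 1` squares to zero and `U ^ m = 1 + m (U - 1)`; characteristic
zero then forces `U = 1`. -/
theorem Matrix.eq_one_of_mulVec_eq_of_det_eq_one {k : Type*} [Field k] [CharZero k]
    {U : Matrix (Fin 2) (Fin 2) k} {v : Fin 2 → k} (hv : v ≠ 0) (hUv : U.mulVec v = v)
    (hdet : U.det = 1) {m : ℕ} (hm : m ≠ 0) (hU : U ^ m = 1) : U = 1 := by
  have h1 : (U - 1).det = 0 :=
    Matrix.exists_mulVec_eq_zero_iff.1 ⟨v, hv, by simp [Matrix.sub_mulVec, hUv]⟩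
  have hN : (U - 1) * (U - 1) = 0 := by
    have htr : U.trace = 2 := by
      rw [Matrix.det_fin_two] at h1 hdet
      simp [Matrix.trace_fin_two] at h1 ⊢
      linear_combination hdet - h1
    have hCH := U.aeval_self_charpoly
    rw [Matrix.charpoly_fin_two, htr, hdet] at hCH
    simp only [map_add, map_sub, map_mul, map_pow, Polynomial.aeval_X, map_ofNat, map_one] at hCH
    rw [← hCH]
    noncomm_ring
  have h2 := pow_one_add_of_mul_self_eq_zero hN m
  rw [add_sub_cancel, hU, left_eq_add] at h2
  have h3 : U - 1 = 0 := by
    ext i j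
    have := congrFun (congrFun h2 i) j
    simpa [hm] using this
  exact sub_eq_zero.1 h3

/-- A commutator fixes `v`, has determinant `1` and has finite order. -/
theorem commute_of_common_eigenvector {k : Type*} [Field k] [CharZero k] {G : Type*} [Group G]
    [Finite G] {A : G →* GL (Fin 2) k} (hA : Function.Injective A) {v : Fin 2 → k} (hv : v ≠ 0)
    {c : G → k} (hc : ∀ g, (A g).val.mulVec v = c g • v) (a b : G) : a * b = b * a := by
  have h : A ((b * a)⁻¹ * (a * b)) = 1 := by
    refine Units.ext (Matrix.eq_one_of_mulVec_eq_of_det_eq_one hv ?_ ?_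
      (orderOf_pos ((b * a)⁻¹ * (a * b))).ne' ?_)
    · have h1 : (A (a * b)).val.mulVec v = (A (b * a)).val.mulVec v := by
        simp only [map_mul, Units.val_mul, ← Matrix.mulVec_mulVec, hc, Matrix.mulVec_smul]
        exact smul_comm _ _ _
      rw [map_mul, Units.val_mul, ← Matrix.mulVec_mulVec, h1, Matrix.mulVec_mulVec,
        ← Units.val_mul, ← map_mul, inv_mul_cancel, map_one, Units.val_one, Matrix.one_mulVec]
    · have h1 : Matrix.GeneralLinearGroup.det (A ((b * a)⁻¹ * (a * b))) = 1 := by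
        simp only [map_mul, map_inv]
        rw [mul_comm (Matrix.GeneralLinearGroup.det (A b)), inv_mul_cancel]
      exact congrArg Units.val h1
    · rw [← Units.val_pow_eq_pow_val, ← map_pow, pow_orderOf_eq_one, map_one, Units.val_one]
  rw [← map_one A] at h
  exact (inv_mul_eq_one.1 (hA h)).symm

end Linear

/-! ### Dominant equivariant maps -/

section Dominant

variable {k : Type*} [Field k] {G : Type*} [Group G]

theorem mem_range_algebraMap_of_isAlgebraic {K : Type*} [Field K] [Algebra k K] [IsAlgClosed k]
    {x : K} (hx : IsAlgebraic k x) : ∃ c : k, algebraMap k K c = x :=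
  minpoly.mem_range_of_degree_eq_one k x
    (IsAlgClosed.degree_eq_one_of_irreducible k (minpoly.irreducible hx.isIntegral))

/-- The coordinate vector `f` of a rational map intertwines the rational action `ρ` with the linear
action given by `A`. -/
def RationalAction.IsEquivariant {n m : ℕ} (ρ : RationalAction G n k) (A : G →* GL (Fin m) k)
    (f : Fin m → RatFunField n k) : Prop :=
  ∀ g i, (ρ.toHom g : DomRatMap n k).pullback (f i) = ∑ j, (A g).val i j • f j

theorem RationalAction.IsEquivariant.exists_eigenvalue {n m : ℕ} {ρ : RationalAction G n k}
    {A : G →* GL (Fin m) k} {v : Fin m → k} {h : RatFunField n k}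
    (hf : ρ.IsEquivariant A fun i => v i • h) (hh : h ≠ 0) (hv : v ≠ 0) :
    ∃ c : G → k, ∀ g, (A g).val.mulVec v = c g • v := by
  obtain ⟨i₀, hi₀⟩ := Function.ne_iff.1 hv
  have hi₀ : v i₀ ≠ 0 := hi₀
  have hA : ∀ g i, v i • (ρ.toHom g : DomRatMap n k).pullback h = (A g).val.mulVec v i • h := by
    intro g i
    rw [← map_smul, hf g i]
    simp [Matrix.mulVec, dotProduct, Finset.sum_smul, smul_smul]
  refine ⟨fun g => (v i₀)⁻¹ * (A g).val.mulVec v i₀, fun g => funext fun i => ?_⟩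
  refine smul_left_injective k hh ?_
  simp only [Pi.smul_apply, smul_eq_mul]
  rw [← hA, mul_comm, mul_smul, mul_smul, ← hA, inv_smul_smul₀ hi₀]

theorem RationalAction.IsEquivariant.transcendental_div [IsAlgClosed k] [CharZero k] [Finite G]
    {n : ℕ} {ρ : RationalAction G n k} {A : G →* GL (Fin 2) k} (hA : Function.Injective A)
    (hG : ¬ ∀ a b : G, a * b = b * a) {f : Fin 2 → RatFunField n k} (hf : ρ.IsEquivariant A f)
    (hf0 : f ≠ 0) : f 1 ≠ 0 ∧ Transcendental k (f 0 / f 1) := by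
  have key : ∀ (v : Fin 2 → k) (h : RatFunField n k), v ≠ 0 → h ≠ 0 → f ≠ fun i => v i • h := by
    rintro v h hv hh rfl
    obtain ⟨c, hc⟩ := hf.exists_eigenvalue hh hv
    exact hG (commute_of_common_eigenvector hA hv hc)
  have h1 : f 1 ≠ 0 := by
    intro h1
    have h0 : f 0 ≠ 0 := by
      intro h0
      exact hf0 (funext fun i => by fin_cases i <;> assumption)
    refine key ![1, 0] (f 0) (fun h => one_ne_zero (congrFun h 0)) h0 (funext fun i => ?_)
    fin_cases i <;> simp [h1]
  refine ⟨h1, fun ht => ?_⟩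
  obtain ⟨c, hc⟩ := mem_range_algebraMap_of_isAlgebraic ht
  refine key ![c, 1] (f 1) (fun h => one_ne_zero (congrFun h 1)) h1 (funext fun i => ?_)
  fin_cases i
  · simp [Algebra.smul_def, hc, h1]
  · simp

/-- The action of `G` on rational functions, `g • f = f ∘ ρ(g)⁻¹`. -/
noncomputable abbrev RationalAction.mulSemiringAction {n : ℕ} (ρ : RationalAction G n k) :
    MulSemiringAction G (RatFunField n k) where
  smul g f := (ρ.toHom g⁻¹ : DomRatMap n k).pullback f
  one_smul f := by
    change (ρ.toHom 1⁻¹ : DomRatMap n k).pullback f = f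
    rw [inv_one, map_one, Units.val_one]
    exact DomRatMap.pullback_id f
  mul_smul g h f := by
    change (ρ.toHom (g * h)⁻¹ : DomRatMap n k).pullback f = _
    rw [mul_inv_rev, map_mul, Units.val_mul, DomRatMap.pullback_mul]
    rfl
  smul_zero _ := map_zero _
  smul_add _ := map_add _
  smul_one _ := map_one _
  smul_mul _ := map_mul _

/-- Otherwise the whole function field would be algebraic over `k[t]`, against transcendence degree
`2`. -/
theorem RationalAction.exists_invariant_transcendental [Finite G] (ρ : RationalAction G 2 k)
    (t : RatFunField 2 k) : ∃ s : RatFunField 2 k,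
      (∀ g, (ρ.toHom g : DomRatMap 2 k).pullback s = s) ∧
        Transcendental (Algebra.adjoin k {t}) s := by
  by_contra! h
  let := ρ.mulSemiringAction
  have hind : AlgebraicIndependent k (DomRatMap.id : DomRatMap 2 k).coord :=
    algebraicIndependent_iff.2 DomRatMap.id.dominant
  refine not_isAlgebraic_adjoin_singleton hind t (isAlgebraic_of_fixedPoints (G := G) _ ?_)
  refine fun s hs => not_not.1 (h s fun g => ?_)
  have := hs g⁻¹
  change (ρ.toHom g⁻¹⁻¹ : DomRatMap 2 k).pullback s = s at this
  rwa [inv_inv] at this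

theorem RationalAction.exists_dominant_equivariant [IsAlgClosed k] [CharZero k] [Finite G]
    (ρ : RationalAction G 2 k) {A : G →* GL (Fin 2) k} (hA : Function.Injective A)
    (hG : ¬ ∀ a b : G, a * b = b * a) :
    ∃ f : Fin 2 → RatFunField 2 k, AlgebraicIndependent k f ∧ ρ.IsEquivariant A f := by
  obtain ⟨f, hf0, hf⟩ : ∃ f, f ≠ 0 ∧ ρ.IsEquivariant A f := ρ.exists_equivariant A
  obtain ⟨h1, ht⟩ := hf.transcendental_div hA hG hf0
  -- Scaling by an invariant `c` keeps both equivariance and the ratio `f 0 / f 1`.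
  obtain ⟨c, hc, hct⟩ : ∃ c : RatFunField 2 k,
      (∀ g, (ρ.toHom g : DomRatMap 2 k).pullback c = c) ∧
        Transcendental (Algebra.adjoin k {f 0 / f 1}) (c * f 1) := by
    by_cases h : IsAlgebraic (Algebra.adjoin k {f 0 / f 1}) (f 1)
    · obtain ⟨s, hs, hst⟩ := ρ.exists_invariant_transcendental (f 0 / f 1)
      refine ⟨s, hs, fun h' => hst ?_⟩
      rw [← mul_div_cancel_right₀ s h1, div_eq_mul_inv]
      exact h'.mul h.inv
    · exact ⟨1, fun g => map_one _, by rwa [one_mul]⟩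
  refine ⟨fun i => c * f i, ?_, fun g i => ?_⟩
  · have hcf : (fun i => c * f i) = ![f 0 / f 1 * (c * f 1), c * f 1] := by
      funext i
      fin_cases i
      · simp only [Fin.zero_eta, Matrix.cons_val_zero]
        field_simp
      · simp
    rw [hcf]
    exact (algebraicIndependent_pair ht hct).pair_mul
  · rw [map_mul, hc, hf g i, Finset.mul_sum]
    simp only [mul_smul_comm]

end Dominant

/-! ### Radial maps and non-birationality -/

section Radial

variable {k : Type*} [Field k] {n : ℕ}

theorem MvPolynomial.aeval_mul_of_isHomogeneous {σ R S : Type*} [CommSemiring R] [CommSemiring S]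
    [Algebra R S] {F : MvPolynomial σ R} {d : ℕ} (hF : F.IsHomogeneous d) (r : S) (x : σ → S) :
    aeval (fun i => r * x i) F = r ^ d * aeval x F := by
  simp only [aeval_def, eval₂_eq, Finset.mul_sum]
  refine Finset.sum_congr rfl fun s hs => ?_
  simp only [mul_pow, Finset.prod_mul_distrib, Finset.prod_pow_eq_pow_sum]
  have hd : ∑ i ∈ s.support, s i = d := by
    rw [← hF (mem_support_iff.1 hs), Finsupp.weight_apply, Finsupp.sum]
    simp
  rw [hd, mul_left_comm]

/-- The rational map `v ↦ F(v) v` attached to a nonzero homogeneous polynomial `F`. -/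
noncomputable def radialMap {F : MvPolynomial (Fin n) k} {d : ℕ} (hF : F.IsHomogeneous d) (hF0 : F ≠ 0) :
    DomRatMap n k where
  coord i := algebraMap (MvPolynomial (Fin n) k) _ (F * X i)
  dominant P hP := by
    let K := AlgebraicClosure (RatFunField n k)
    let x : Fin n → K := fun i => algebraMap (RatFunField n k) K (DomRatMap.id.coord i)
    have hx : ∀ Q : MvPolynomial (Fin n) k, aeval x Q = 0 → Q = 0 := by
      intro Q hQ
      have hQ := (aeval_algebraMap_apply K _ Q).symm.trans hQ
      exact DomRatMap.id.dominant Q ((map_eq_zero _).1 hQ)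
    -- Since `r ^ (d + 1) * F(x) = 1`, the radial map sends `r x` to the generic point `x`.
    obtain ⟨r, hr⟩ := IsAlgClosed.exists_pow_nat_eq (aeval x F)⁻¹ d.succ_pos
    rw [aeval_algebraMap_coord] at hP
    have h1 := (map_eq_zero_iff _ (IsFractionRing.injective _ _)).1 hP
    refine hx P ?_
    have h2 := congrArg (aeval fun i => r * x i) h1
    rw [← AlgHom.comp_apply, comp_aeval, map_zero] at h2
    rw [← h2]
    congr 2
    funext i
    rw [map_mul, aeval_mul_of_isHomogeneous hF, aeval_X, mul_mul_mul_comm, ← pow_succ, ← Nat.succ_eq_add_one, hr,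
      ← mul_assoc, inv_mul_cancel₀ (fun h => hF0 (hx F h)), one_mul]

theorem linearRatMap_scalar_coord (u : kˣ) (i : Fin n) :
    (linearRatMap (Units.map (algebraMap k (Matrix (Fin n) (Fin n) k)).toMonoidHom u)).coord i =
      algebraMap (MvPolynomial (Fin n) k) _ (C u.val * X i) := by
  simp [linearRatMap, linearForm, Matrix.algebraMap_matrix_apply, apply_ite C, ite_mul]

theorem not_isBirational_radialMap [IsAlgClosed k] [CharZero k] [NeZero n]
    {F : MvPolynomial (Fin n) k} {d : ℕ} (hF : F.IsHomogeneous d) (hF0 : F ≠ 0) (hd : d ≠ 0) :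
    ¬ (radialMap hF hF0).IsBirational := by
  intro h
  obtain ⟨ζ, hζ⟩ := HasEnoughRootsOfUnity.exists_primitiveRoot k (d + 1)
  let u : kˣ := (hζ.isUnit d.succ_ne_zero).unit
  let μ := linearRatMap (n := n)
    (Units.map (algebraMap k (Matrix (Fin n) (Fin n) k)).toMonoidHom u)
  have h1 : radialMap hF hF0 * μ = radialMap hF hF0 := by
    refine DomRatMap.ext (funext fun i => ?_)
    change μ.pullback (algebraMap _ _ (F * X i)) = algebraMap _ _ (F * X i)
    rw [DomRatMap.pullback_algebraMap]
    have hμ : μ.coord = fun i => algebraMap (MvPolynomial (Fin n) k) _ (C ζ * X i) :=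
      _root_.funext fun i => linearRatMap_scalar_coord u i
    rw [hμ, aeval_algebraMap_coord, map_mul, aeval_mul_of_isHomogeneous hF, aeval_X, aeval_X_left_apply,
      mul_mul_mul_comm, ← pow_succ, ← map_pow, hζ.pow_eq_one, map_one, one_mul]
  -- An invertible radial map could be cancelled, making the homothety by `ζ` trivial.
  have h2 : μ = 1 := (IsUnit.mul_eq_left h).1 h1
  have h3 : algebraMap (MvPolynomial (Fin n) k) (RatFunField n k) (C ζ * X 0) =
      algebraMap (MvPolynomial (Fin n) k) _ (X 0) :=
    (linearRatMap_scalar_coord u 0).symm.trans (congrFun (congrArg DomRatMap.coord h2) 0)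
  have h4 : C ζ * X 0 = (X 0 : MvPolynomial (Fin n) k) := IsFractionRing.injective _ _ h3
  have h5 : ζ = 1 := by simpa using congrArg (eval fun _ => 1) h4
  exact hζ.ne_one (by lia) h5

theorem radialMap_mul_linearRatMap {F : MvPolynomial (Fin n) k} {d : ℕ} (hF : F.IsHomogeneous d)
    (hF0 : F ≠ 0) {A : GL (Fin n) k} (hA : aeval (linearForm A.val) F = F) :
    radialMap hF hF0 * linearRatMap A = linearRatMap A * radialMap hF hF0 := by
  refine DomRatMap.ext (funext fun i => ?_)
  change (linearRatMap A).pullback (algebraMap _ _ (F * X i)) =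
    (radialMap hF hF0).pullback (algebraMap _ _ (linearForm A.val i))
  rw [DomRatMap.pullback_algebraMap, DomRatMap.pullback_algebraMap]
  refine (aeval_algebraMap_coord _ _).trans (Eq.trans ?_ (aeval_algebraMap_coord _ _).symm)
  rw [map_mul, hA, aeval_X]
  simp [linearForm, Finset.mul_sum, mul_left_comm]

/-- The product of all translates of the first coordinate is invariant, as `G` permutes its factors.
-/
theorem exists_homogeneous_invariant {G : Type*} [Group G] [Finite G] [NeZero n]
    (A : G →* GL (Fin n) k) : ∃ F : MvPolynomial (Fin n) k, F ≠ 0 ∧ F.IsHomogeneous (Nat.card G) ∧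
      ∀ g, aeval (linearForm (A g).val) F = F := by
  have := Fintype.ofFinite G
  refine ⟨∏ g, linearForm (A g).val 0, Finset.prod_ne_zero_iff.2 fun g _ h => ?_, ?_, fun g => ?_⟩
  · have h1 := congrArg (aeval (linearForm (A g⁻¹).val)) h
    rw [aeval_linearForm, ← Units.val_mul, ← map_mul, mul_inv_cancel, map_one, Units.val_one,
      linearForm_one, map_zero] at h1
    exact X_ne_zero _ h1
  · have h1 := IsHomogeneous.prod Finset.univ (fun g => linearForm (A g).val 0) (fun _ => 1)
      fun g _ => IsHomogeneous.sum _ _ _ fun j _ => by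
        simpa using (isHomogeneous_C (Fin n) ((A g).val 0 j)).mul (isHomogeneous_X k j)
    simpa using h1
  · simp only [map_prod, aeval_linearForm, ← Units.val_mul, ← map_mul]
    exact Fintype.prod_equiv (Equiv.mulRight g) _ _ fun _ => rfl

end Radial

theorem isCompression_linearAction_iff {k : Type*} [Field k] {G : Type*} [Group G] {n : ℕ}
    {ρ : RationalAction G n k} {lam : G →* GL (Fin n) k} {hlam : Function.Injective lam}
    {φ : DomRatMap n k} :
    IsCompression ρ (linearAction lam hlam) φ ↔ ρ.IsEquivariant lam φ.coord := by
  refine forall_congr' fun g => DomRatMap.ext_iff.trans (funext_iff.trans (forall_congr' fun i => ?_))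
  change (ρ.toHom g : DomRatMap n k).pullback (φ.coord i) =
    φ.pullback (algebraMap _ _ (linearForm (lam g).val i)) ↔ _
  rw [DomRatMap.pullback_algebraMap]
  simp [linearForm, Algebra.smul_def]

theorem mainTheorem3 {k : Type*} [Field k] [IsAlgClosed k] [CharZero k]
    {G : Type*} [Group G] [Finite G]
    (hnonabelian : ¬ ∀ a b : G, a * b = b * a)
    (hnondihedral : ∀ m : ℕ, IsEmpty (G ≃* DihedralGroup m))
    (lam : G →* GL (Fin 2) k) (hlam : Function.Injective lam)
    (ρ : RationalAction G 2 k) :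
    IsNontrivialBaseChange ρ (linearAction lam hlam) := by
  obtain ⟨f, hind, hf⟩ := ρ.exists_dominant_equivariant hlam hnonabelian
  let φ : DomRatMap 2 k := ⟨f, algebraicIndependent_iff.1 hind⟩
  have hφ : IsCompression ρ (linearAction lam hlam) φ := isCompression_linearAction_iff.2 hf
  by_cases hbir : φ.IsBirational
  · obtain ⟨F, hF0, hF, hinv⟩ := exists_homogeneous_invariant lam
    refine ⟨radialMap hF hF0 * φ, fun g => ?_, fun h => ?_⟩
    · rw [mul_assoc, hφ g, ← mul_assoc, ← mul_assoc]
      exact congrArg (· * φ) (radialMap_mul_linearRatMap hF hF0 (hinv g))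
    · exact not_isBirational_radialMap hF hF0 Nat.card_pos.ne' ((IsUnit.mul_right_iff hbir).1 h)
  · exact ⟨φ, hφ, hbir⟩
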